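/- Let $N\ge 1$, let $p,q,c\in\mathbb{C}\setminus\{0\}$, and let $\mathcal A_\pm$ be non-singular lower triangular Toeplitz $N\times N$ matrices over $\mathbb{C}$. For $n,m,\alpha,\beta\in\mathbb{Z}$, $l\in\mathbb{Z}_{\ge0}$ and $a,b\ne0$ put $\Phi(\alpha,\beta,l)=\mathcal A_+\Phi^+(\alpha,\beta,l)+\mathcal A_-\Phi^-(\alpha,\beta,l)$, where $\Phi^\pm=(\phi^\pm_0,\dots,\phi^\pm_{N-1})^T$ and $$\phi^\pm_s(\alpha,\beta,l)=\frac1{(2s)!}\,\partial_k^{2s}\Big[(p\pm k)^n(q\pm k)^m(a\pm k)^\alpha(b\pm k)^\beta(c\pm k)^{l+1/2}\Big]_{k=0},$$ with the branch $(c\pm k)^{l+1/2}=c^{l+1/2}(1\pm k/c)^{l+1/2}$ (principal powers). Let $|\alpha,\beta|=\det\big(\Phi(\alpha,\beta,0),\dots,\Phi(\alpha,\beta,N-1)\big)$, let $f=f_{n,m}=|0,0|$ (which does not depend on $a,b$), and let $$S(a,b)=-\frac{1}{(a+b)f}\Big((ab)^N\,|-1,-1|-f\Big),$$ where $S(a,-a)$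 is the limit of $S(a,b)$ as $b\to -a$ (these are the rational solutions of the NQC equation). Let $\mathcal U(a,-a)=-\frac1{2a}\partial_\epsilon S(a,2a\epsilon-a)|_{\epsilon=0}$, $\mathcal U(-a,a)=\frac1{2a}\partial_\epsilon S(-a,a-2a\epsilon)|_{\epsilon=0}$, $\xi=2a\big(\frac{pn}{a^2-p^2}+\frac{qm}{a^2-q^2}\big)$, $\rho(a)=\big(\frac{p+a}{p-a}\big)^n\big(\frac{q+a}{q-a}\big)^m$, and let $$u^{Q2}(a;A,D,\xi_0)=\tfrac14\big((\xi+\xi_0)^2+1\big)+a(\xi+\xi_0)S(-a,a)+a^2\big(\mathcal U(a,-a)+\mathcal U(-a,a)\big)+AD+\tfrac12A\rho(a)\big(1-2aS(a,a)\big)+\tfrac12D\rho(-a)\big(1+2aS(-a,-a)\big)$$ be the rational solution of Q2. Then there are functions $S^{(0)},S^{(1)}$ of $(n,m)\in\mathbb{Z}^2$ with the following properties. 1. At every $(n,m)$ with $f_{n,m}\ne0$: for every $a\ne0$ the limit $S(a,-a)$ exists and $b\mapsto S(a,b)$, with this value at $b=-a$, is complex differentiable at $b=-a$. As $\epsilon\to0$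 in $\mathbb{C}\setminus\{0\}$, with $a=1/\epsilon$, $$aS(-a,a)=-\epsilon S^{(0)}+O(\epsilon^2),\quad aS(a,a)=\epsilon S^{(0)}-2\epsilon^2S^{(1)}+O(\epsilon^3),$$ $$aS(-a,-a)=\epsilon S^{(0)}+2\epsilon^2S^{(1)}+O(\epsilon^3),\quad a^2\big(\mathcal U(-a,a)+\mathcal U(a,-a)\big)=2\epsilon^2S^{(1)}+O(\epsilon^3).$$ Moreover, for all constants $A,\zeta_0,\zeta_1\in\mathbb{C}$, $$\lim_{\epsilon\to0}\frac1{\epsilon^2}\Big(u^{Q2}\big(\tfrac1\epsilon;\,A(\epsilon+\tfrac12\zeta_1\epsilon^2),\,A(-\epsilon+\tfrac12\zeta_1\epsilon^2),\,\epsilon\zeta_0\big)-\tfrac14\Big)=u_{n,m},$$ where, with $\zeta=2(np+mq)$, $$u_{n,m}=\tfrac14(\zeta+\zeta_0)^2-(\zeta+\zeta_0)S^{(0)}+2S^{(1)}-A^2+(-1)^{n+m}A\big(\zeta+\tfrac12\zeta_1-2S^{(0)}\big).$$ 2. For all $A,\zeta_0,\zeta_1\in\mathbb{C}$ this $u$ solves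 H2, $$(u_{n,m}-u_{n+1,m+1})(u_{n+1,m}-u_{n,m+1})+(p^2-q^2)(u_{n,m}+u_{n+1,m}+u_{n,m+1}+u_{n+1,m+1})=p^4-q^4,$$ on every elementary quadrilateral at whose four vertices $f\ne0$. 3. $S^{(0)}$ and $S^{(1)}$ are rational in $(n,m)$: there are polynomials $F,G_0,G_1\in\mathbb{C}[x,y]$ such that $F(n,m)=0$ exactly where $f_{n,m}=0$, and $S^{(0)}=G_0(n,m)/F(n,m)$, $S^{(1)}=G_1(n,m)/F(n,m)$ wherever $f_{n,m}\ne0$. -/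

import Mathlib

open Filter Topology Asymptotics

noncomputable section

/-- Lower triangular Toeplitz matrices: the entries depend only on `i - j` and vanish above
the diagonal. -/
def IsLowerTriangularToeplitz {N : ℕ} (M : Matrix (Fin N) (Fin N) ℂ) : Prop :=
  ∃ t : ℕ → ℂ, ∀ i j : Fin N, M i j = if j ≤ i then t ((i : ℕ) - (j : ℕ)) else 0

/-- The generating function
`(p + σ k)^n (q + σ k)^m (a + σ k)^α (b + σ k)^β (c + σ k)^(l + 1/2)` with `σ = ± 1`.
The last factor is written as `c^(l + 1/2) (1 + σ k / c)^(l + 1/2)` (principal powers); for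
`c ≠ 0` this is a branch of `(c + σ k)^(l + 1/2)` that is holomorphic in `k` near `k = 0`. -/
def genFun (p q c a b σ : ℂ) (n m α β : ℤ) (l : ℕ) (k : ℂ) : ℂ :=
  (p + σ * k) ^ n * (q + σ * k) ^ m * (a + σ * k) ^ α * (b + σ * k) ^ β *
    (c ^ ((l : ℂ) + 1 / 2) * (1 + σ * k / c) ^ ((l : ℂ) + 1 / 2))

/-- The vector `Φ^±(α, β, l)` (`σ = ± 1`), with entries
`φ_s = (1 / (2 s)!) ∂_k^(2 s) genFun |_(k = 0)`, `s = 0, …, N - 1`. -/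
def basicVec (N : ℕ) (p q c a b σ : ℂ) (n m α β : ℤ) (l : ℕ) : Fin N → ℂ := fun s =>
  iteratedDeriv (2 * (s : ℕ)) (genFun p q c a b σ n m α β l) 0 /
    ((Nat.factorial (2 * (s : ℕ)) : ℕ) : ℂ)

/-- The Casoratian `|Φ(α, β, 0), Φ(α, β, 1), …, Φ(α, β, N - 1)|` of
`Φ = Ap Φ⁺ + Am Φ⁻`. -/
def casoratian {N : ℕ} (Ap Am : Matrix (Fin N) (Fin N) ℂ) (p q c a b : ℂ)
    (n m α β : ℤ) : ℂ :=
  Matrix.det (Matrix.of fun i l : Fin N =>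
    (Ap.mulVec (basicVec N p q c a b 1 n m α β (l : ℕ)) +
      Am.mulVec (basicVec N p q c a b (-1) n m α β (l : ℕ))) i)

/-- The Casoratian `f` with `α = β = 0`. The parameters `a`, `b` enter only through the powers
`(a ± k)^0 = (b ± k)^0 = 1`, so that they are set to `1`. -/
def tauF {N : ℕ} (Ap Am : Matrix (Fin N) (Fin N) ℂ) (p q c : ℂ) (n m : ℤ) : ℂ :=
  casoratian Ap Am p q c 1 1 n m 0 0

/-- The quotient `θ / f`, `θ = - (1 / (a + b)) ((a b)^N |Φ(-1, -1, 0), …| - f)`, which is the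
rational solution `S(a, b)` of the NQC equation for `a + b ≠ 0`. -/
def nqcSRaw {N : ℕ} (Ap Am : Matrix (Fin N) (Fin N) ℂ) (p q c : ℂ) (n m : ℤ) (a b : ℂ) : ℂ :=
  (-(1 / (a + b)) * ((a * b) ^ N * casoratian Ap Am p q c a b n m (-1) (-1)
    - tauF Ap Am p q c n m)) / tauF Ap Am p q c n m

/-- The rational solution `S(a, b)` of the NQC equation; at `b = -a` its value is
the limit `b → -a`. -/
def nqcS {N : ℕ} (Ap Am : Matrix (Fin N) (Fin N) ℂ) (p q c : ℂ) (n m : ℤ) (a : ℂ) : ℂ → ℂ :=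
  Function.update (nqcSRaw Ap Am p q c n m a) (-a)
    (limUnder (𝓝[≠] (-a)) (nqcSRaw Ap Am p q c n m a))

/-- `U(a, -a) = - (1 / (2 a)) ∂_e S(a, 2 a e - a) |_(e = 0)`. With `a` replaced by `-a` this is
`U(-a, a) = (1 / (2 a)) ∂_e S(-a, a - 2 a e) |_(e = 0)`. -/
def nqcU {N : ℕ} (Ap Am : Matrix (Fin N) (Fin N) ℂ) (p q c : ℂ) (n m : ℤ) (a : ℂ) : ℂ :=
  -(1 / (2 * a)) * deriv (fun e : ℂ => nqcS Ap Am p q c n m a (2 * a * e - a)) 0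

/-- `ρ(a) = ((p + a) / (p - a))^n ((q + a) / (q - a))^m`. -/
def rho (p q : ℂ) (n m : ℤ) (a : ℂ) : ℂ :=
  ((p + a) / (p - a)) ^ n * ((q + a) / (q - a)) ^ m

/-- `ξ = 2 a (p n / (a^2 - p^2) + q m / (a^2 - q^2))`. -/
def xiVar (p q : ℂ) (n m : ℤ) (a : ℂ) : ℂ :=
  2 * a * (p / (a ^ 2 - p ^ 2) * (n : ℂ) + q / (a ^ 2 - q ^ 2) * (m : ℂ))

/-- The rational solution of Q2 with parameter `a` and constants `A`, `D`, `ξ₀`. -/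
def q2Sol {N : ℕ} (Ap Am : Matrix (Fin N) (Fin N) ℂ) (p q c : ℂ) (n m : ℤ)
    (a A D ξ₀ : ℂ) : ℂ :=
  1 / 4 * ((xiVar p q n m a + ξ₀) ^ 2 + 1)
    + a * (xiVar p q n m a + ξ₀) * nqcS Ap Am p q c n m (-a) a
    + a ^ 2 * (nqcU Ap Am p q c n m a + nqcU Ap Am p q c n m (-a))
    + A * D
    + 1 / 2 * A * rho p q n m a * (1 - 2 * a * nqcS Ap Am p q c n m a a)
    + 1 / 2 * D * rho p q n m (-a) * (1 + 2 * a * nqcS Ap Am p q c n m (-a) (-a))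

/-- `S₀` and `S₁` are the coefficients `S^(0)`, `S^(1)` in the expansions, with `a = 1 / ε` and
`ε → 0`, of the NQC solution at the lattice point `(n, m)`. -/
def IsNqcExpansion {N : ℕ} (Ap Am : Matrix (Fin N) (Fin N) ℂ) (p q c : ℂ) (n m : ℤ)
    (S₀ S₁ : ℂ) : Prop :=
  ((fun ε : ℂ => 1 / ε * nqcS Ap Am p q c n m (-(1 / ε)) (1 / ε) - (-ε * S₀))
      =O[𝓝[≠] 0] fun ε : ℂ => ε ^ 2) ∧
  ((fun ε : ℂ => 1 / ε * nqcS Ap Am p q c n m (1 / ε) (1 / ε) - (ε * S₀ - 2 * ε ^ 2 * S₁))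
      =O[𝓝[≠] 0] fun ε : ℂ => ε ^ 3) ∧
  ((fun ε : ℂ => 1 / ε * nqcS Ap Am p q c n m (-(1 / ε)) (-(1 / ε))
        - (ε * S₀ + 2 * ε ^ 2 * S₁))
      =O[𝓝[≠] 0] fun ε : ℂ => ε ^ 3) ∧
  ((fun ε : ℂ => (1 / ε) ^ 2 *
        (nqcU Ap Am p q c n m (-(1 / ε)) + nqcU Ap Am p q c n m (1 / ε)) - 2 * ε ^ 2 * S₁)
      =O[𝓝[≠] 0] fun ε : ℂ => ε ^ 3)

/-- `ζ = 2 (n p + m q)`. -/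
def zetaVar (p q : ℂ) (n m : ℤ) : ℂ := 2 * ((n : ℂ) * p + (m : ℂ) * q)

/-- `u = (ζ + ζ₀)^2 / 4 - (ζ + ζ₀) S^(0) + 2 S^(1) - A^2 + (-1)^(n+m) A (ζ + ζ₁/2 - 2 S^(0))`. -/
def h2Sol (S₀ S₁ : ℤ → ℤ → ℂ) (p q A ζ₀ ζ₁ : ℂ) (n m : ℤ) : ℂ :=
  1 / 4 * (zetaVar p q n m + ζ₀) ^ 2 - (zetaVar p q n m + ζ₀) * S₀ n m + 2 * S₁ n m - A ^ 2
    + (-1 : ℂ) ^ (n + m) * A * (zetaVar p q n m + ζ₁ / 2 - 2 * S₀ n m)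

/-- The H2 equation for `u` on the elementary quadrilateral with lower left corner `(n, m)`. -/
def SatisfiesH2At (p q : ℂ) (u : ℤ → ℤ → ℂ) (n m : ℤ) : Prop :=
  (u n m - u (n + 1) (m + 1)) * (u (n + 1) m - u n (m + 1))
    + (p ^ 2 - q ^ 2) * (u n m + u (n + 1) m + u n (m + 1) + u (n + 1) (m + 1))
    = p ^ 4 - q ^ 4

end

/-! Only even derivatives at `k = 0` occur, so `Φ⁺ = Φ⁻` and the Casoratian factors as `det (Ap +
Am)` times a determinant of even Taylor coefficients. Column operations replace `(c + k) ^ l` by `k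
^ l`, which leaves `τ(h) = tau N h` with `h` the generating function. With `x = 1 / a`, `y = 1 / b`,
the normalized Casoratian `(a b)^N |-1, -1|` becomes `τ(h / ((1 + x k)(1 + y k)))`, a polynomial in
`x, y`. Multiplying `h` by an even series with constant term 1 acts on the columns by a unipotent
matrix, so at `y = -x` this polynomial equals `τ(h)`. Hence its difference with `τ(h)` is `(x + y)
R(x, y)` with `R` a polynomial (`exists_tauTwo_sub`), and `S(a, b) = -x y R(x, y) / τ`. This is
regular at `b = -a`, and its expansion as `a → ∞` is the Taylor expansion of `R` at the origin.

Restricting to the axes `x = 0` and `y = 0` (`tau_mul_geo`) gives `R = -τ₁ + τ₂ (x + y) + …`, where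
`τᵢ` has its last column raised by `k ^ i`. So `S₀ = τ₁ / τ` and `S₁ = τ₂ / τ`, and the limit of the
Q2 solution is a second-order expansion in `ε`.

H2 rests on one relation per edge, `p (S̃₀ - S₀) = S̃₁ + S₁ - S̃₀ S₀` (`tauLast_div_tau_relation`),
where the tilde is multiplication of `h` by `p + k`. It is linear algebra: a column is expanded in
two bases, and multiplication by `k ^ 2`, being nilpotent on even coefficients, has trace zero. The
edge relations make `Y = (ζ + ζ₀) / 2 - S₀ - (-1)^(n+m) A` a solution of H1 with `u + ũ = p² + 2 Y
Ỹ`, and H2 is then an algebraic consequence (`satisfiesH2At_h2Sol`). Rationality holds because the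
Taylor coefficients of `(1 + k / p) ^ n` are polynomials in `n`. -/

/-- The coefficients of `1, k ^ 2, …, k ^ (2 N - 2)` in a power series. -/
noncomputable def evenCoeffs (N : ℕ) {R : Type*} [CommRing R] (h : PowerSeries R) : Fin N → R :=
  fun s => PowerSeries.coeff (2 * (s : ℕ)) h

/-- The matrix with columns `evenCoeffs N (h k ^ l)`, `l < N`. -/
noncomputable def tauMat (N : ℕ) {R : Type*} [CommRing R] (h : PowerSeries R) : Matrix (Fin N) (Fin N) R :=
  Matrix.of fun s l => evenCoeffs N (h * PowerSeries.X ^ (l : ℕ)) s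

/-- The determinant of the columns `h k ^ l`, `l < N`. -/
noncomputable def tau (N : ℕ) {R : Type*} [CommRing R] (h : PowerSeries R) : R := (tauMat N h).det

/-- `tau` with its last column `h k ^ (N - 1)` replaced by `h k ^ (N - 1 + i)`. -/
noncomputable def tauLast {R : Type*} [CommRing R] : (N i : ℕ) → (h : PowerSeries R) → R
  | 0, _, _ => 0
  | M + 1, i, h => ((tauMat (M + 1) h).updateCol (Fin.last M)
      (evenCoeffs (M + 1) (h * PowerSeries.X ^ (M + i)))).det

/-- The power series `1 / (1 + x k)`. -/
noncomputable def geo {R : Type*} [CommRing R] (x : R) : PowerSeries R := PowerSeries.mk fun i => (-x) ^ i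

/-! ### Determinants of even coefficients over a commutative ring -/

section Algebra

variable {R S : Type*} [CommRing R] [CommRing S]

theorem evenCoeffs_add (N : ℕ) (g h : PowerSeries R) :
    evenCoeffs N (g + h) = evenCoeffs N g + evenCoeffs N h := by
  ext s; simp [evenCoeffs]

theorem evenCoeffs_C_mul (N : ℕ) (r : R) (h : PowerSeries R) :
    evenCoeffs N (PowerSeries.C r * h) = r • evenCoeffs N h := by
  ext s; simp [evenCoeffs]

theorem evenCoeffs_map (N : ℕ) (φ : R →+* S) (h : PowerSeries R) (s : Fin N) :
    evenCoeffs N (PowerSeries.map φ h) s = φ (evenCoeffs N h s) := by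
  simp [evenCoeffs]

theorem tauMat_map (N : ℕ) (φ : R →+* S) (h : PowerSeries R) :
    tauMat N (PowerSeries.map φ h) = φ.mapMatrix (tauMat N h) := by
  ext s l
  simp [tauMat, ← evenCoeffs_map]

/-- Naturality allows `x, y` and `n, m` to be treated as indeterminates first and specialized later.
-/
theorem tau_map (N : ℕ) (φ : R →+* S) (h : PowerSeries R) :
    tau N (PowerSeries.map φ h) = φ (tau N h) := by
  rw [tau, tauMat_map, tau, RingHom.map_det]

theorem tauLast_map (N i : ℕ) (φ : R →+* S) (h : PowerSeries R) :
    tauLast N i (PowerSeries.map φ h) = φ (tauLast N i h) := by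
  cases N with
  | zero => simp [tauLast]
  | succ M =>
    rw [tauLast, tauLast, RingHom.map_det, tauMat_map]
    congr 1
    ext s l
    by_cases hl : l = Fin.last M
    · subst hl
      simp [← evenCoeffs_map]
    · simp [Matrix.updateCol_ne hl]

theorem tauMat_C_mul (N : ℕ) (r : R) (h : PowerSeries R) :
    tauMat N (PowerSeries.C r * h) = r • tauMat N h := by
  ext s l
  simp [tauMat, mul_assoc, evenCoeffs_C_mul]

theorem tau_C_mul (N : ℕ) (r : R) (h : PowerSeries R) :
    tau N (PowerSeries.C r * h) = r ^ N * tau N h := by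
  rw [tau, tauMat_C_mul, Matrix.det_smul, tau, Fintype.card_fin]

theorem tauLast_C_mul (N i : ℕ) (r : R) (h : PowerSeries R) :
    tauLast N i (PowerSeries.C r * h) = r ^ N * tauLast N i h := by
  cases N with
  | zero => simp [tauLast]
  | succ M =>
    have : (tauMat (M + 1) (PowerSeries.C r * h)).updateCol (Fin.last M)
        (evenCoeffs (M + 1) (PowerSeries.C r * h * PowerSeries.X ^ (M + i))) =
        r • (tauMat (M + 1) h).updateCol (Fin.last M)
        (evenCoeffs (M + 1) (h * PowerSeries.X ^ (M + i))) := by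
      ext s l
      by_cases hl : l = Fin.last M
      · subst hl
        simp [mul_assoc, evenCoeffs_C_mul]
      · simp [Matrix.updateCol_ne hl, tauMat_C_mul]
    rw [tauLast, this, Matrix.det_smul, tauLast, Fintype.card_fin]

/-- The nilpotent matrix with ones below the diagonal. -/
noncomputable def shiftMat (N : ℕ) (R : Type*) [CommRing R] : Matrix (Fin N) (Fin N) R :=
  Matrix.of fun i j => if (j : ℕ) + 1 = (i : ℕ) then 1 else 0

theorem shiftMat_mulVec (N : ℕ) (h : PowerSeries R) :
    (shiftMat N R).mulVec (evenCoeffs N h) = evenCoeffs N (h * PowerSeries.X ^ 2) := by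
  ext s
  simp only [Matrix.mulVec, dotProduct, shiftMat, Matrix.of_apply, evenCoeffs,
    PowerSeries.coeff_mul_X_pow']
  by_cases hs : (s : ℕ) = 0
  · simp [hs]
  · rw [Finset.sum_eq_single (⟨(s : ℕ) - 1, by omega⟩ : Fin N)]
    · rw [if_pos (by simp; omega), if_pos (by omega), one_mul]
      congr 2
      simp; omega
    · intro j _ hj
      rw [if_neg, zero_mul]
      intro h1
      apply hj
      ext
      simp
      omega
    · simp

/-- Multiplication by `k ^ 2` shifts the even coefficients down by one place, so the even factor
acts on all columns at once by `1 + z • shiftMat N R`, which is lower triangular with unit diagonal.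
-/
theorem tau_eq_of_mul_even (N : ℕ) (z : R) (h' h : PowerSeries R)
    (hh : h' * (1 + PowerSeries.C z * PowerSeries.X ^ 2) = h) : tau N h' = tau N h := by
  have key : tauMat N h = (1 + z • shiftMat N R) * tauMat N h' := by
    ext s l
    have := congrFun (shiftMat_mulVec N (h' * PowerSeries.X ^ (l : ℕ))) s
    simp only [Matrix.mulVec, dotProduct] at this
    rw [add_mul, one_mul, Matrix.add_apply, Matrix.smul_mul, Matrix.smul_apply, Matrix.mul_apply]
    simp only [tauMat, Matrix.of_apply] at this ⊢
    rw [this, ← hh]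
    have e : h' * (1 + PowerSeries.C z * PowerSeries.X ^ 2) * PowerSeries.X ^ (l : ℕ) =
      h' * PowerSeries.X ^ (l : ℕ) +
        PowerSeries.C z * (h' * PowerSeries.X ^ (l : ℕ) * PowerSeries.X ^ 2) := by ring
    rw [e, evenCoeffs_add, evenCoeffs_C_mul]
    simp
  rw [tau, tau, key, Matrix.det_mul, Matrix.det_of_isLowerTriangular (M := 1 + z • shiftMat N R)]
  · simp [shiftMat]
  · intro i j hij
    have hij' : (i : ℕ) < j := by simpa using hij
    have h1 : i ≠ j := by rintro rfl; omega
    simp [h1, shiftMat]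
    omega

theorem geo_mul (x : R) : geo x * (1 + PowerSeries.C x * PowerSeries.X) = 1 := by
  ext n
  rw [mul_add, mul_one, mul_left_comm, map_add, PowerSeries.coeff_C_mul]
  cases n with
  | zero => simp [geo]
  | succ n => simp [geo, pow_succ, PowerSeries.coeff_one, mul_comm]

theorem geo_map (φ : R →+* S) (x : R) : PowerSeries.map φ (geo x) = geo (φ x) := by
  ext n; simp [geo]

theorem geo_zero : geo (0 : R) = 1 := by
  simpa using geo_mul (0 : R)

/-- Since `(1 + x k) geo x = 1`, adding `x` times the next column removes `geo x` from every column
but the last. The determinant is linear in that last column, where `geo x` is expanded as a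
geometric series up to order 3. -/
theorem tau_mul_geo (N : ℕ) (h : PowerSeries R) (x : R) : ∃ E : R,
    tau N (h * geo x) = tau N h - x * tauLast N 1 h + x ^ 2 * tauLast N 2 h + x ^ 3 * E := by
  cases N with
  | zero => exact ⟨0, by simp [tau, tauLast]⟩
  | succ M =>
    set v : PowerSeries R → R := fun g =>
      ((tauMat (M + 1) h).updateCol (Fin.last M) (evenCoeffs (M + 1) g)).det with hv
    have hadd : ∀ g₁ g₂, v (g₁ + g₂) = v g₁ + v g₂ := fun g₁ g₂ => by
      simp only [hv, evenCoeffs_add, Matrix.det_updateCol_add]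
    have hC : ∀ r g, v (PowerSeries.C r * g) = r * v g := fun r g => by
      simp only [hv, evenCoeffs_C_mul, Matrix.det_updateCol_smul]
    have h0 : tau (M + 1) h = v (h * PowerSeries.X ^ M) := by
      simp only [hv, tau]
      congr 1
      ext s l
      by_cases hl : l = Fin.last M
      · subst hl; simp [tauMat]
      · simp [Matrix.updateCol_ne hl]
    have hg := geo_mul x
    -- The column operations as right multiplication by a bidiagonal matrix of determinant 1. The
    -- last column has no successor, so it alone keeps `geo x`.
    have hmat : tauMat (M + 1) (h * geo x) *
        (Matrix.of fun i j : Fin (M + 1) =>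
          if i = j then 1 else if (i : ℕ) = j + 1 then x else 0) =
        (tauMat (M + 1) h).updateCol (Fin.last M)
          (evenCoeffs (M + 1) (h * geo x * PowerSeries.X ^ M)) := by
      ext s l
      rw [Matrix.mul_apply]
      by_cases hl : l = Fin.last M
      · subst hl
        rw [Finset.sum_eq_single (Fin.last M)]
        · simp [tauMat]
        · intro i _ hi
          have : (i : ℕ) ≠ M + 1 := by omega
          simp [hi, this]
        · simp
      · have hlM : (l : ℕ) < M := by
          have := l.2
          have h2 : (l : ℕ) ≠ M := fun h3 => hl (Fin.ext h3)
          omega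
        set l' : Fin (M + 1) := ⟨(l : ℕ) + 1, by omega⟩ with hl'
        have hne : l ≠ l' := by
          intro h3
          have := congrArg Fin.val h3
          simp [hl'] at this
        rw [Finset.sum_eq_add l l' hne]
        · rw [Matrix.updateCol_ne hl]
          simp only [tauMat, Matrix.of_apply, if_true, mul_one, hne.symm, if_false]
          rw [if_pos (by simp [hl'])]
          have e : h * PowerSeries.X ^ (l : ℕ) =
              h * geo x * PowerSeries.X ^ (l : ℕ) +
                PowerSeries.C x * (h * geo x * PowerSeries.X ^ (l' : ℕ)) := by
            simp only [hl', pow_succ]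
            linear_combination (-h * PowerSeries.X ^ (l : ℕ)) * hg
          rw [e, evenCoeffs_add, evenCoeffs_C_mul]
          simp [mul_comm x]
        · intro i _ hi
          have h3 : (i : ℕ) ≠ (l : ℕ) + 1 := fun h4 => hi.2 (Fin.ext h4)
          simp [hi.1, h3]
        · simp
        · simp
    have hdet := congrArg Matrix.det hmat
    rw [Matrix.det_mul, Matrix.det_of_isLowerTriangular (M := Matrix.of fun i j : Fin (M + 1) =>
          if i = j then 1 else if (i : ℕ) = j + 1 then x else 0) (by
      intro i j hij
      have hij' : (i : ℕ) < j := by simpa using hij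
      have h1 : i ≠ j := by rintro rfl; omega
      have h2 : (i : ℕ) ≠ j + 1 := by omega
      simp [h1, h2])] at hdet
    simp only [Matrix.of_apply, if_true, Finset.prod_const_one, mul_one] at hdet
    refine ⟨-v (h * geo x * PowerSeries.X ^ (M + 3)), ?_⟩
    change tau (M + 1) (h * geo x) = v _ at hdet
    have e : h * geo x * PowerSeries.X ^ M = h * PowerSeries.X ^ M +
        PowerSeries.C (-x) * (h * PowerSeries.X ^ (M + 1)) +
        PowerSeries.C (x ^ 2) * (h * PowerSeries.X ^ (M + 2)) +
        PowerSeries.C (-x ^ 3) * (h * geo x * PowerSeries.X ^ (M + 3)) := by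
      simp only [map_neg, map_pow, pow_add, pow_one]
      linear_combination (h * PowerSeries.X ^ M * (1 - PowerSeries.C x * PowerSeries.X +
        PowerSeries.C x ^ 2 * PowerSeries.X ^ 2)) * hg
    rw [hdet, e, hadd, hadd, hadd, hC, hC, hC, ← h0]
    simp only [tauLast, hv]
    ring

/-- The product `(1 + x k)(1 - x k) = 1 - x² k²` is even. This is what cancels the pole of `S(a, b)`
at `b = -a`. -/
theorem tau_mul_geo_mul_geo_neg (N : ℕ) (h : PowerSeries R) (x : R) :
    tau N (h * geo x * geo (-x)) = tau N h := by
  apply tau_eq_of_mul_even N (-x ^ 2)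
  have h1 := geo_mul x
  have h2 := geo_mul (-x)
  simp only [map_neg, map_pow] at *
  linear_combination h * h1 + h * geo x * (1 + PowerSeries.C x * PowerSeries.X) * h2

/-- The change of basis from monomials to monic polynomials of degrees `0, …, N - 1` is
unitriangular. It is applied to the powers of `k + c`. -/
theorem det_evenCoeffs_mul_monic (N : ℕ) (h : PowerSeries R) (P : Fin N → Polynomial R)
    (hdeg : ∀ i, (P i).natDegree = i) (hmon : ∀ i, (P i).Monic) :
    (Matrix.of fun s l : Fin N => evenCoeffs N (h * (P l : PowerSeries R)) s).det = tau N h := by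
  have key : (Matrix.of fun s l : Fin N => evenCoeffs N (h * (P l : PowerSeries R)) s) =
      tauMat N h * Matrix.of fun i j : Fin N => (P j).coeff i := by
    ext s l
    have e : (P l : PowerSeries R) =
        ∑ i : Fin N, PowerSeries.C ((P l).coeff i) * PowerSeries.X ^ (i : ℕ) := by
      conv_lhs => rw [(P l).as_sum_range_C_mul_X_pow' (n := N) (by rw [hdeg]; exact l.2)]
      rw [← Fin.sum_univ_eq_sum_range
        (fun i => Polynomial.C ((P l).coeff i) * Polynomial.X ^ i) N]
      rw [← Polynomial.coeToPowerSeries.ringHom_apply, map_sum]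
      simp
    rw [Matrix.mul_apply]
    conv_lhs => rw [Matrix.of_apply, e]
    simp only [evenCoeffs, tauMat, Matrix.of_apply, Finset.mul_sum, map_sum]
    refine Finset.sum_congr rfl fun i _ => ?_
    rw [mul_left_comm, PowerSeries.coeff_C_mul, mul_comm]
  rw [key, Matrix.det_mul, Matrix.det_matrixOfPolynomials P hdeg hmon, mul_one, tau]

end Algebra

/-! ### The bilinear edge relation -/

section Bilinear

variable {K : Type*} [Field K]

/-- The coordinates of `h k ^ j` with respect to `h, h k, …, h k ^ (N - 1)`. -/
noncomputable def colCoord (N : ℕ) (h : PowerSeries K) (j : ℕ) : Fin N → K :=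
  (tauMat N h)⁻¹.mulVec (evenCoeffs N (h * PowerSeries.X ^ j))

theorem tauMat_mulVec_single (N : ℕ) (h : PowerSeries K) (j : Fin N) :
    (tauMat N h).mulVec (Pi.single j 1) = evenCoeffs N (h * PowerSeries.X ^ (j : ℕ)) := by
  ext s
  simp [tauMat]

theorem colCoord_of_lt {N : ℕ} {h : PowerSeries K} (h0 : tau N h ≠ 0) (j : Fin N) :
    colCoord N h j = Pi.single j 1 := by
  have hu : IsUnit (tauMat N h).det := isUnit_iff_ne_zero.mpr h0
  rw [colCoord, ← tauMat_mulVec_single, Matrix.mulVec_mulVec, Matrix.nonsing_inv_mul _ hu,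
    Matrix.one_mulVec]

theorem tauMat_mulVec_colCoord {N : ℕ} {h : PowerSeries K} (h0 : tau N h ≠ 0) (j : ℕ) :
    (tauMat N h).mulVec (colCoord N h j) = evenCoeffs N (h * PowerSeries.X ^ j) := by
  have hu : IsUnit (tauMat N h).det := isUnit_iff_ne_zero.mpr h0
  rw [colCoord, Matrix.mulVec_mulVec, Matrix.mul_nonsing_inv _ hu, Matrix.one_mulVec]

/-- Cramer's rule. -/
theorem colCoord_last {M : ℕ} {h : PowerSeries K} (h0 : tau (M + 1) h ≠ 0) (i : ℕ) :
    colCoord (M + 1) h (M + i) (Fin.last M) = tauLast (M + 1) i h / tau (M + 1) h := by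
  have hu : IsUnit (tauMat (M + 1) h).det := isUnit_iff_ne_zero.mpr h0
  have := congrFun (Matrix.det_smul_inv_mulVec_eq_cramer (tauMat (M + 1) h)
    (evenCoeffs (M + 1) (h * PowerSeries.X ^ (M + i))) hu) (Fin.last M)
  rw [Matrix.cramer_apply] at this
  rw [eq_div_iff h0, mul_comm]
  exact this

/-- The sum is the trace of multiplication by `k ^ 2` in the basis of columns, a conjugate of the
shift matrix, whose diagonal vanishes. -/
theorem sum_colCoord_add_two {N : ℕ} {h : PowerSeries K} (h0 : tau N h ≠ 0) :
    ∑ l : Fin N, colCoord N h (l + 2) l = 0 := by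
  have hu : IsUnit (tauMat N h).det := isUnit_iff_ne_zero.mpr h0
  have h1 : ((tauMat N h)⁻¹ * (shiftMat N K * tauMat N h)).trace = 0 := by
    rw [Matrix.trace_mul_comm, Matrix.mul_assoc, Matrix.mul_nonsing_inv _ hu, mul_one]
    simp [Matrix.trace, shiftMat]
  rw [← h1]
  refine Finset.sum_congr rfl fun l _ => ?_
  have h2 := congrFun (congrArg ((tauMat N h)⁻¹.mulVec)
    (shiftMat_mulVec N (h * PowerSeries.X ^ (l : ℕ)))) l
  rw [← tauMat_mulVec_single, Matrix.mulVec_mulVec, Matrix.mulVec_mulVec, mul_assoc h,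
    ← pow_add] at h2
  rw [colCoord, ← h2]
  simp [Matrix.mul_assoc]

/-- In the trace of multiplication by `k ^ 2`, every column except the last two is sent to another
basis column and contributes nothing to the diagonal. -/
theorem colCoord_trace {M : ℕ} {h : PowerSeries K} (h0 : tau (M + 2) h ≠ 0) :
    colCoord (M + 2) h (M + 2) (Fin.last M).castSucc
      + colCoord (M + 2) h (M + 3) (Fin.last (M + 1)) = 0 := by
  have h1 := sum_colCoord_add_two h0
  rw [Fin.sum_univ_castSucc, Fin.sum_univ_castSucc, Finset.sum_eq_zero, zero_add] at h1
  · simpa using h1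
  · intro l _
    have := colCoord_of_lt h0 ⟨(l : ℕ) + 2, by omega⟩
    simp only [Fin.val_castSucc] at this ⊢
    rw [this, Pi.single_eq_of_ne]
    intro h2
    have := congrArg Fin.val h2
    simp at this

/-- The Hirota bilinear relation between `tau N h` and `tau N ((p + k) h)`, in terms of the
quotients `tauLast / tau`. -/
theorem tauLast_div_tau_relation (N : ℕ) (h : PowerSeries K) (p : K) (h0 : tau N h ≠ 0)
    (h1 : tau N ((PowerSeries.C p + PowerSeries.X) * h) ≠ 0) :
    p * (tauLast N 1 ((PowerSeries.C p + PowerSeries.X) * h)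
          / tau N ((PowerSeries.C p + PowerSeries.X) * h) - tauLast N 1 h / tau N h) =
      tauLast N 2 ((PowerSeries.C p + PowerSeries.X) * h)
          / tau N ((PowerSeries.C p + PowerSeries.X) * h) + tauLast N 2 h / tau N h
        - tauLast N 1 ((PowerSeries.C p + PowerSeries.X) * h)
          / tau N ((PowerSeries.C p + PowerSeries.X) * h) * (tauLast N 1 h / tau N h) := by
  -- The trace argument needs two columns. For `N = 0` and `N = 1` every `tauLast` that occurs is
  -- zero.
  match N with
  | 0 => simp [tauLast]
  | 1 =>
    have h2 : ∀ (g : PowerSeries K) (i : ℕ), i ≠ 0 → tauLast 1 i g = 0 := fun g i hi => by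
      simp [tauLast, evenCoeffs, hi]
    simp [h2]
  | M + 2 =>
    set g := (PowerSeries.C p + PowerSeries.X) * h with hg
    have e0 : ∀ j, evenCoeffs (M + 2) (g * PowerSeries.X ^ j) =
        p • evenCoeffs (M + 2) (h * PowerSeries.X ^ j) +
          evenCoeffs (M + 2) (h * PowerSeries.X ^ (j + 1)) := fun j => by
      rw [← evenCoeffs_C_mul, ← evenCoeffs_add, hg]
      congr 1
      ring
    have e1 : ∀ j, (tauMat (M + 2) h)⁻¹.mulVec (evenCoeffs (M + 2) (g * PowerSeries.X ^ j)) =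
        p • colCoord (M + 2) h j + colCoord (M + 2) h (j + 1) := fun j => by
      rw [e0, Matrix.mulVec_add, Matrix.mulVec_smul]; rfl
    -- The column `g k ^ N`, with `N = M + 2`, is expanded in the columns of `g`. Both sides are
    -- then rewritten in the columns of `h` through `g = (p + k) h`, and the last coordinate is
    -- compared.
    have e2 : evenCoeffs (M + 2) (g * PowerSeries.X ^ (M + 2)) =
        ∑ l : Fin (M + 2), colCoord (M + 2) g (M + 2) l •
          evenCoeffs (M + 2) (g * PowerSeries.X ^ (l : ℕ)) := by
      rw [← tauMat_mulVec_colCoord h1]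
      ext s
      simp [Matrix.mulVec, dotProduct, tauMat, mul_comm]
    have e3 := congrFun (congrArg ((tauMat (M + 2) h)⁻¹.mulVec) e2) (Fin.last (M + 1))
    rw [e1, Matrix.mulVec_sum] at e3
    simp only [Matrix.mulVec_smul, e1] at e3
    rw [Fin.sum_univ_castSucc, Fin.sum_univ_castSucc] at e3
    simp only [Fin.val_castSucc, Fin.val_last, Pi.add_apply, Pi.smul_apply, Finset.sum_apply,
      smul_eq_mul] at e3
    -- For `l < N - 2` both `h k ^ l` and `h k ^ (l + 1)` are basis columns other than the last, so
    -- only the last two terms survive.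
    rw [Finset.sum_eq_zero, zero_add] at e3
    · have l0 := congrFun (colCoord_of_lt h0 (Fin.last M).castSucc) (Fin.last (M + 1))
      have l1 := congrFun (colCoord_of_lt h0 (Fin.last (M + 1))) (Fin.last (M + 1))
      rw [Pi.single_eq_of_ne (Fin.castSucc_lt_last _).ne'] at l0
      rw [Pi.single_eq_same] at l1
      simp only [Fin.val_castSucc, Fin.val_last] at l0 l1
      have t0 := colCoord_trace h0
      have t1 := colCoord_trace h1
      have s1 := colCoord_last h0 1
      have s2 := colCoord_last h0 2
      have s3 := colCoord_last h1 1
      have s4 := colCoord_last h1 2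
      simp only [add_assoc, Nat.reduceAdd] at *
      rw [l0, l1, s1, s2, s3] at e3
      rw [s4] at t1
      -- The remaining coordinate of `g k ^ N`, the one at position `N - 2`, is eliminated by the
      -- trace identity for `g`.
      linear_combination -e3 + (-1 : K) * t1
    · intro l _
      have a0 := congrFun (colCoord_of_lt h0 ⟨(l : ℕ), by omega⟩) (Fin.last (M + 1))
      have a1 := congrFun (colCoord_of_lt h0 ⟨(l : ℕ) + 1, by omega⟩) (Fin.last (M + 1))
      rw [Pi.single_eq_of_ne] at a0 a1
      · simp only at a0 a1
        rw [a0, a1]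
        ring
      · intro h2
        have := congrArg Fin.val h2
        simp at this
        omega
      · intro h2
        have := congrArg Fin.val h2
        simp at this
        omega

end Bilinear

/-! ### Division by `x + y` and the expansion at the origin -/

section Divided

open Polynomial

/-- `tau` of `h / ((1 + x k) (1 + y k))` as a polynomial in `x` (inner variable) and `y`. -/
noncomputable def tauTwo (N : ℕ) (h : PowerSeries ℂ) : ℂ[X][X] :=
  tau N (PowerSeries.map ((C : ℂ[X] →+* ℂ[X][X]).comp C) h * geo (C X : ℂ[X][X]) *
    geo (X : ℂ[X][X]))

theorem map_tauTwo (N : ℕ) (h : PowerSeries ℂ) {S : Type*} [CommRing S] (φ : ℂ[X][X] →+* S) :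
    φ (tauTwo N h) = tau N (PowerSeries.map (φ.comp ((C : ℂ[X] →+* ℂ[X][X]).comp C)) h * geo (φ (C X)) *
      geo (φ X)) := by
  rw [tauTwo, ← tau_map, map_mul, map_mul, geo_map, geo_map, PowerSeries.map_comp]
  rfl

/-- The quotient of `tauTwo - tau` by `x + y`, expanded to first order. -/
theorem exists_tauTwo_sub (N : ℕ) (h : PowerSeries ℂ) : ∃ R U₁ U₂ U₃ : ℂ[X][X],
    tauTwo N h - C (C (tau N h)) = (X + C X) * R ∧
    R = C (C (-tauLast N 1 h)) + C (C (tauLast N 2 h)) * (C X + X) +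
      C X ^ 2 * U₁ + C X * X * U₂ + X ^ 2 * U₃ := by
  -- As a polynomial in the outer variable `y`, the difference has the root `y = -x`.
  have hdvd : X - C (-X) ∣ tauTwo N h - C (C (tau N h)) := by
    rw [dvd_iff_isRoot, IsRoot.def, eval_sub, ← coe_evalRingHom, map_tauTwo]
    simp only [coe_evalRingHom, eval_X, eval_C]
    rw [tau_mul_geo_mul_geo_neg, tau_map, sub_eq_zero]
    simp
  obtain ⟨R, hR⟩ := hdvd
  rw [map_neg, sub_neg_eq_add] at hR
  have hX : (X : ℂ[X]) ≠ 0 := X_ne_zero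
  -- the restrictions to the coordinate axes
  have hy : ∃ E : ℂ[X], eval 0 R = -C (tauLast N 1 h) + X * C (tauLast N 2 h) + X ^ 2 * E := by
    obtain ⟨E, hE⟩ := tau_mul_geo N (PowerSeries.map C h) (X : ℂ[X])
    have h1 := congrArg (evalRingHom (0 : ℂ[X])) hR
    rw [map_sub, map_tauTwo, map_mul] at h1
    have h2 : (evalRingHom (0 : ℂ[X])).comp ((C : ℂ[X] →+* ℂ[X][X]).comp C) = (C : ℂ →+* ℂ[X]) := by
      ext; simp
    rw [h2] at h1
    simp only [coe_evalRingHom, eval_add, eval_X, eval_C, geo_zero, mul_one, zero_add] at h1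
    rw [hE, tau_map, tauLast_map, tauLast_map] at h1
    exact ⟨E, mul_left_cancel₀ hX (by linear_combination -h1)⟩
  have hx : ∃ E : ℂ[X], R.map (evalRingHom 0) =
      -C (tauLast N 1 h) + X * C (tauLast N 2 h) + X ^ 2 * E := by
    obtain ⟨E, hE⟩ := tau_mul_geo N (PowerSeries.map C h) (X : ℂ[X])
    have h1 := congrArg (mapRingHom (evalRingHom (0 : ℂ))) hR
    rw [map_sub, map_tauTwo, map_mul] at h1
    have h2 : (mapRingHom (evalRingHom (0 : ℂ))).comp ((C : ℂ[X] →+* ℂ[X][X]).comp C) = (C : ℂ →+* ℂ[X]) := by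
      ext; simp
    rw [h2] at h1
    simp only [coe_mapRingHom, Polynomial.map_add, map_X, map_C, coe_evalRingHom, eval_X, eval_C,
      C_0, geo_zero, mul_one, add_zero] at h1
    rw [hE, tau_map, tauLast_map, tauLast_map] at h1
    exact ⟨E, mul_left_cancel₀ hX (by linear_combination -h1)⟩
  obtain ⟨Ey, hy⟩ := hy
  obtain ⟨Ex, hx⟩ := hx
  rw [← coeff_zero_eq_eval_zero] at hy
  have hx1 := congrArg (fun g => coeff g 1) hx
  simp only [coeff_map, coeff_add, coeff_neg, coeff_C_succ, coeff_X_mul, coeff_C_zero, neg_zero,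
    zero_add, coeff_X_pow_mul', coe_evalRingHom] at hx1
  norm_num at hx1
  rw [← coeff_zero_eq_eval_zero] at hx1
  -- The axis `y = 0` determines the coefficient of `y ^ 0` up to `x ^ 2`, and the axis `x = 0` the
  -- constant term of the coefficient of `y`. All other terms lie in the ideal `(x², x y, y²)`.
  refine ⟨R, C Ey, C (R.coeff 1).divX, R.divX.divX, hR, ?_⟩
  have d0 := divX_mul_X_add R
  have d1 := divX_mul_X_add R.divX
  have d2 := divX_mul_X_add (R.coeff 1)
  rw [coeff_divX] at d1
  rw [hx1] at d2
  rw [hy] at d0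
  norm_num at d1
  have d2' := congrArg (C : ℂ[X] →+* ℂ[X][X]) d2
  simp only [map_add, map_mul, map_neg, map_pow] at d0 d1 d2' ⊢
  linear_combination -d0 - X * d1 - X * d2'

end Divided

/-! ### Taylor series of the generating function and the Casoratian -/

/-- The Taylor series at `0`. -/
noncomputable def taylorPS (f : ℂ → ℂ) : PowerSeries ℂ :=
  PowerSeries.mk fun n => iteratedDeriv n f 0 / (n.factorial : ℂ)

theorem taylorPS_congr {f g : ℂ → ℂ} (h : f =ᶠ[𝓝 0] g) : taylorPS f = taylorPS g := by
  ext n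
  simp [taylorPS, h.iteratedDeriv_eq n]

theorem taylorPS_mul {f g : ℂ → ℂ} (hf : AnalyticAt ℂ f 0) (hg : AnalyticAt ℂ g 0) :
    taylorPS (fun k => f k * g k) = taylorPS f * taylorPS g := by
  ext n
  rw [PowerSeries.coeff_mul, Finset.Nat.sum_antidiagonal_eq_sum_range_succ_mk]
  simp only [taylorPS, PowerSeries.coeff_mk]
  have := iteratedDeriv_mul (n := n) hf.contDiffAt hg.contDiffAt
  change iteratedDeriv n (f * g) 0 / _ = _
  rw [this, Finset.sum_div]
  refine Finset.sum_congr rfl fun i hi => ?_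
  have hi' : i ≤ n := by simpa [Nat.lt_succ_iff] using hi
  rw [Nat.cast_choose ℂ hi']
  have h1 : (n.factorial : ℂ) ≠ 0 := by exact_mod_cast n.factorial_ne_zero
  field_simp

theorem taylorPS_one : taylorPS (fun _ => 1) = 1 := by
  ext n
  cases n with
  | zero => simp [taylorPS]
  | succ n => simp [taylorPS, iteratedDeriv_const, PowerSeries.coeff_one]

theorem taylorPS_const_add (p : ℂ) :
    taylorPS (fun k => p + k) = PowerSeries.C p + PowerSeries.X := by
  ext n
  match n with
  | 0 => simp [taylorPS]
  | 1 => simp [taylorPS, iteratedDeriv_one]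
  | n + 2 =>
    have h1 : iteratedDeriv 1 (fun k : ℂ => p + k) = fun _ => 1 := by
      ext x; simp [iteratedDeriv_one]
    have : iteratedDeriv (n + 2) (fun k : ℂ => p + k) 0 = 0 := by
      rw [iteratedDeriv_succ', ← iteratedDeriv_one, h1]
      simp [iteratedDeriv_const]
    simp [taylorPS, this, PowerSeries.coeff_X]

theorem analyticAt_const_add_zpow {p : ℂ} (hp : p ≠ 0) (n : ℤ) :
    AnalyticAt ℂ (fun k : ℂ => (p + k) ^ n) 0 :=
  AnalyticAt.fun_zpow (by fun_prop) (by simpa using hp)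

/-- The Taylor series of `(p + k) ^ n`. -/
noncomputable def zpowPS (p : ℂ) (n : ℤ) : PowerSeries ℂ := taylorPS fun k => (p + k) ^ n

theorem zpowPS_zero (p : ℂ) : zpowPS p 0 = 1 := by simp [zpowPS, taylorPS_one]

theorem eventually_const_add_ne_zero {p : ℂ} (hp : p ≠ 0) : ∀ᶠ k : ℂ in 𝓝 0, p + k ≠ 0 := by
  have : ContinuousAt (fun k : ℂ => p + k) 0 := by fun_prop
  exact this.eventually_ne (by simpa using hp)

theorem zpowPS_add_one {p : ℂ} (hp : p ≠ 0) (n : ℤ) :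
    zpowPS p (n + 1) = (PowerSeries.C p + PowerSeries.X) * zpowPS p n := by
  rw [zpowPS, zpowPS, ← taylorPS_const_add,
    ← taylorPS_mul (by fun_prop) (analyticAt_const_add_zpow hp n)]
  apply taylorPS_congr
  filter_upwards [eventually_const_add_ne_zero hp] with k hk
  rw [zpow_add_one₀ hk, mul_comm]

theorem zpowPS_neg_one {p : ℂ} (hp : p ≠ 0) :
    zpowPS p (-1) = PowerSeries.C p⁻¹ * geo p⁻¹ := by
  have h1 := zpowPS_add_one hp (-1)
  rw [neg_add_cancel, zpowPS_zero] at h1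
  have h2 := geo_mul p⁻¹
  have h3 : PowerSeries.C p⁻¹ * PowerSeries.C p = 1 := by
    rw [← map_mul, inv_mul_cancel₀ hp, map_one]
  linear_combination (-PowerSeries.C p⁻¹ * geo p⁻¹) * h1 - zpowPS p (-1) * h2 -
    geo p⁻¹ * zpowPS p (-1) * h3

theorem zpowPS_natCast {p : ℂ} (hp : p ≠ 0) (l : ℕ) :
    zpowPS p l = (PowerSeries.C p + PowerSeries.X) ^ l := by
  induction l with
  | zero => simpa using zpowPS_zero p
  | succ l ih => rw [Nat.cast_succ, zpowPS_add_one hp, ih, pow_succ']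

theorem coeff_zpowPS (p : ℂ) (n : ℤ) (j : ℕ) : PowerSeries.coeff j (zpowPS p n) =
    (∏ i ∈ Finset.range j, ((n : ℂ) - i)) * p ^ (n - j) / (j.factorial : ℂ) := by
  have h1 := congrFun (iteratedDeriv_comp_const_add j (fun k : ℂ => k ^ n) p) 0
  rw [zpowPS, taylorPS, PowerSeries.coeff_mk, h1, iteratedDeriv_eq_iterate, iter_deriv_zpow,
    add_zero]

/-- The Taylor series of `(c + k) ^ (1 / 2)`. -/
noncomputable def sqrtPS (c : ℂ) : PowerSeries ℂ :=
  taylorPS fun k => c ^ ((1 : ℂ) / 2) * (1 + k / c) ^ ((1 : ℂ) / 2)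

/-- The Taylor series of the generating function at `α = β = l = 0`. -/
noncomputable def basePS (p q c : ℂ) (n m : ℤ) : PowerSeries ℂ :=
  zpowPS p n * zpowPS q m * sqrtPS c

theorem basePS_add_one_left {p : ℂ} (hp : p ≠ 0) (q c : ℂ) (n m : ℤ) :
    basePS p q c (n + 1) m = (PowerSeries.C p + PowerSeries.X) * basePS p q c n m := by
  rw [basePS, basePS, zpowPS_add_one hp]; ring

theorem basePS_add_one_right (p : ℂ) {q : ℂ} (hq : q ≠ 0) (c : ℂ) (n m : ℤ) :
    basePS p q c n (m + 1) = (PowerSeries.C q + PowerSeries.X) * basePS p q c n m := by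
  rw [basePS, basePS, zpowPS_add_one hq]; ring

theorem taylorPS_genFun {p q c a b : ℂ} (hp : p ≠ 0) (hq : q ≠ 0) (hc : c ≠ 0) (ha : a ≠ 0)
    (hb : b ≠ 0) (n m α β : ℤ) (l : ℕ) :
    taylorPS (genFun p q c a b 1 n m α β l) =
      basePS p q c n m * (zpowPS a α * zpowPS b β) * (PowerSeries.C c + PowerSeries.X) ^ l := by
  have hp' := analyticAt_const_add_zpow hp n
  have hq' := analyticAt_const_add_zpow hq m
  have ha' := analyticAt_const_add_zpow ha α
  have hb' := analyticAt_const_add_zpow hb β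
  have hl := analyticAt_const_add_zpow hc l
  have hs : AnalyticAt ℂ (fun k : ℂ => c ^ ((1 : ℂ) / 2) * (1 + k / c) ^ ((1 : ℂ) / 2)) 0 := by
    refine analyticAt_const.mul (AnalyticAt.cpow ?_ analyticAt_const (by simp))
    exact analyticAt_const.add (analyticAt_id.div_const)
  rw [basePS, ← zpowPS_natCast hc]
  simp only [zpowPS, sqrtPS]
  rw [← taylorPS_mul hp' hq', ← taylorPS_mul (hp'.fun_mul hq') hs, ← taylorPS_mul ha' hb',
    ← taylorPS_mul ((hp'.fun_mul hq').fun_mul hs) (ha'.fun_mul hb'),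
    ← taylorPS_mul (((hp'.fun_mul hq').fun_mul hs).fun_mul (ha'.fun_mul hb')) hl]
  apply taylorPS_congr
  -- The exponent `l + 1 / 2` may be split into `l` and `1 / 2` only where `1 + k / c ≠ 0`, hence
  -- only near `k = 0`.
  filter_upwards [eventually_const_add_ne_zero hc] with k hk
  have h2 : c + k = c * (1 + k / c) := by field_simp
  have h1 : 1 + k / c ≠ 0 := right_ne_zero_of_mul (h2 ▸ hk)
  simp only [genFun, one_mul]
  rw [Complex.cpow_add _ _ hc, Complex.cpow_add _ _ h1, Complex.cpow_natCast,
    Complex.cpow_natCast, zpow_natCast, h2, mul_pow]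
  ring

theorem basicVec_eq (N : ℕ) (p q c a b : ℂ) (n m α β : ℤ) (l : ℕ) :
    basicVec N p q c a b 1 n m α β l =
      evenCoeffs N (taylorPS (genFun p q c a b 1 n m α β l)) := by
  ext s
  simp [basicVec, evenCoeffs, taylorPS]

/-- Changing the sign `σ` is the substitution `k ↦ -k`, which even derivatives at `0` do not see.
Therefore only `Ap + Am` matters. -/
theorem basicVec_neg_one (N : ℕ) (p q c a b : ℂ) (n m α β : ℤ) (l : ℕ) :
    basicVec N p q c a b (-1) n m α β l = basicVec N p q c a b 1 n m α β l := by
  ext s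
  have h1 : genFun p q c a b (-1) n m α β l = fun k => genFun p q c a b 1 n m α β l (-k) := by
    ext k; simp [genFun]
  rw [basicVec, basicVec, h1, iteratedDeriv_comp_neg]
  simp

theorem casoratian_eq {N : ℕ} (Ap Am : Matrix (Fin N) (Fin N) ℂ) {p q c a b : ℂ} (hp : p ≠ 0)
    (hq : q ≠ 0) (hc : c ≠ 0) (ha : a ≠ 0) (hb : b ≠ 0) (n m α β : ℤ) :
    casoratian Ap Am p q c a b n m α β =
      (Ap + Am).det * tau N (basePS p q c n m * (zpowPS a α * zpowPS b β)) := by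
  rw [← det_evenCoeffs_mul_monic N _
    (fun l : Fin N => (Polynomial.X + Polynomial.C c) ^ (l : ℕ)) (by simp)
    (fun i => (Polynomial.monic_X_add_C c).pow _), ← Matrix.det_mul, casoratian]
  congr 1
  ext i l
  rw [Matrix.of_apply, basicVec_neg_one, ← Matrix.add_mulVec, basicVec_eq,
    taylorPS_genFun hp hq hc ha hb, Matrix.mul_apply]
  simp only [Matrix.mulVec, dotProduct, Matrix.of_apply]
  refine Finset.sum_congr rfl fun j _ => ?_
  simp [add_comm]

theorem tauF_eq {N : ℕ} (Ap Am : Matrix (Fin N) (Fin N) ℂ) {p q c : ℂ} (hp : p ≠ 0)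
    (hq : q ≠ 0) (hc : c ≠ 0) (n m : ℤ) :
    tauF Ap Am p q c n m = (Ap + Am).det * tau N (basePS p q c n m) := by
  rw [tauF, casoratian_eq Ap Am hp hq hc one_ne_zero one_ne_zero]
  simp [zpowPS_zero]

/-- From `(a + k)⁻¹ = a⁻¹ geo a⁻¹`, each of the `N` columns carries a factor `(a b)⁻¹`, which the
prefactor absorbs. -/
theorem casoratian_neg_one {N : ℕ} (Ap Am : Matrix (Fin N) (Fin N) ℂ) {p q c a b : ℂ}
    (hp : p ≠ 0) (hq : q ≠ 0) (hc : c ≠ 0) (ha : a ≠ 0) (hb : b ≠ 0) (n m : ℤ) :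
    (a * b) ^ N * casoratian Ap Am p q c a b n m (-1) (-1) =
      (Ap + Am).det * tau N (basePS p q c n m * geo a⁻¹ * geo b⁻¹) := by
  rw [casoratian_eq Ap Am hp hq hc ha hb, zpowPS_neg_one ha, zpowPS_neg_one hb]
  have : basePS p q c n m * (PowerSeries.C a⁻¹ * geo a⁻¹ * (PowerSeries.C b⁻¹ * geo b⁻¹)) =
      PowerSeries.C (a⁻¹ * b⁻¹) * (basePS p q c n m * geo a⁻¹ * geo b⁻¹) := by
    rw [map_mul]; ring
  rw [this, tau_C_mul, mul_left_comm, ← mul_assoc ((a * b) ^ N), ← mul_pow]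
  have : a * b * (a⁻¹ * b⁻¹) = 1 := by field_simp
  rw [this, one_pow, one_mul]

/-! ### Polynomial dependence on the lattice point -/

/-- `(1 + k / p) ^ ν` with polynomial `ν`. -/
noncomputable def binomPS (p : ℂ) {R : Type*} [CommRing R] [Algebra ℂ R] (ν : R) :
    PowerSeries R :=
  PowerSeries.mk fun j => (∏ i ∈ Finset.range j, (ν - i)) *
    algebraMap ℂ R ((p ^ j)⁻¹ / (j.factorial : ℂ))

theorem zpowPS_eq_binomPS {p : ℂ} (hp : p ≠ 0) (n : ℤ) :
    zpowPS p n = PowerSeries.C (p ^ n) * binomPS p (n : ℂ) := by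
  ext j
  rw [coeff_zpowPS, PowerSeries.coeff_C_mul, binomPS, PowerSeries.coeff_mk, zpow_sub₀ hp]
  simp only [zpow_natCast, Algebra.algebraMap_self, RingHom.id_apply]
  field_simp

theorem binomPS_map (p : ℂ) {R S : Type*} [CommRing R] [Algebra ℂ R] [CommRing S] [Algebra ℂ S]
    (φ : R →ₐ[ℂ] S) (ν : R) : PowerSeries.map (φ : R →+* S) (binomPS p ν) = binomPS p (φ ν) := by
  ext j
  simp [binomPS]

/-- Up to normalization, `basePS` with its coefficients written as polynomials in `(n, m)`. -/
noncomputable def polyPS (p q c : ℂ) : PowerSeries (MvPolynomial (Fin 2) ℂ) :=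
  binomPS p (MvPolynomial.X 0) * binomPS q (MvPolynomial.X 1) *
    PowerSeries.map MvPolynomial.C (sqrtPS c)

theorem basePS_eq {p q : ℂ} (hp : p ≠ 0) (hq : q ≠ 0) (c : ℂ) (n m : ℤ) :
    basePS p q c n m = PowerSeries.C (p ^ n * q ^ m) *
      PowerSeries.map (MvPolynomial.eval ![(n : ℂ), (m : ℂ)]) (polyPS p q c) := by
  have h1 := binomPS_map p (MvPolynomial.aeval ![(n : ℂ), (m : ℂ)])
    (MvPolynomial.X 0 : MvPolynomial (Fin 2) ℂ)
  have h2 := binomPS_map q (MvPolynomial.aeval ![(n : ℂ), (m : ℂ)])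
    (MvPolynomial.X 1 : MvPolynomial (Fin 2) ℂ)
  have h3 : ((MvPolynomial.aeval ![(n : ℂ), (m : ℂ)] :
      MvPolynomial (Fin 2) ℂ →ₐ[ℂ] ℂ) : MvPolynomial (Fin 2) ℂ →+* ℂ) =
      MvPolynomial.eval ![(n : ℂ), (m : ℂ)] := by
    ext <;> simp
  rw [h3, MvPolynomial.aeval_X] at h1 h2
  have h4 : PowerSeries.map (MvPolynomial.eval ![(n : ℂ), (m : ℂ)])
      (PowerSeries.map MvPolynomial.C (sqrtPS c)) = sqrtPS c := by
    ext j; simp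
  rw [polyPS, map_mul, map_mul, map_mul, h1, h2, h4, basePS, zpowPS_eq_binomPS hp, zpowPS_eq_binomPS hq]
  simp only [Matrix.cons_val_zero, Matrix.cons_val_one]
  ring

/-! ### The NQC solution as a polynomial in `1 / a` and `1 / b` -/

section EvalEval

open Polynomial

theorem continuous_evalEval {f g : ℂ → ℂ} (hf : Continuous f) (hg : Continuous g) (U : ℂ[X][X]) :
    Continuous fun e => evalEval (f e) (g e) U := by
  have : (fun e => evalEval (f e) (g e) U) = fun e =>
      ∑ i ∈ Finset.range (U.natDegree + 1), (U.coeff i).eval (f e) * g e ^ i := by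
    ext e
    rw [evalEval, eval_eq_sum_range (p := U), eval_finsetSum]
    simp
  rw [this]
  refine continuous_finsetSum _ fun i _ => ?_
  exact ((U.coeff i).continuous.comp hf).mul (hg.pow i)

theorem hasDerivAt_evalEval (x y : ℂ) (U : ℂ[X][X]) :
    HasDerivAt (fun y => evalEval x y U) (evalEval x y (derivative U)) y := by
  simp only [← map_evalRingHom_eval]
  rw [← derivative_map]
  exact Polynomial.hasDerivAt _ _

end EvalEval

section NQC

open Polynomial

variable {N : ℕ} (Ap Am : Matrix (Fin N) (Fin N) ℂ) {p q c : ℂ} (hp : p ≠ 0) (hq : q ≠ 0)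
  (hc : c ≠ 0) {n m : ℤ} (hf : tauF Ap Am p q c n m ≠ 0) {R : ℂ[X][X]}
  (hR : tauTwo N (basePS p q c n m) - C (C (tau N (basePS p q c n m))) = (X + C X) * R)

include hp hq hc hf in
theorem tau_basePS_ne_zero : tau N (basePS p q c n m) ≠ 0 := by
  rw [tauF_eq Ap Am hp hq hc] at hf
  exact right_ne_zero_of_mul hf

theorem evalEval_tauTwo (x y : ℂ) (h : PowerSeries ℂ) :
    evalEval x y (tauTwo N h) = tau N (h * geo x * geo y) := by
  rw [← coe_evalEvalRingHom, map_tauTwo]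
  have : (evalEvalRingHom x y).comp ((C : ℂ[X] →+* ℂ[X][X]).comp C) = RingHom.id ℂ := by
    ext; simp
  rw [this]
  simp

include hp hq hc hf hR in
-- The factor `a⁻¹ + b⁻¹ = (a + b) / (a b)` in front of `R` cancels the denominator `a + b`.
theorem nqcSRaw_eq {a b : ℂ} (ha : a ≠ 0) (hb : b ≠ 0) (hab : a + b ≠ 0) :
    nqcSRaw Ap Am p q c n m a b =
      -(a⁻¹ * (b⁻¹ * evalEval a⁻¹ b⁻¹ R)) / tau N (basePS p q c n m) := by
  have h1 := congrArg (evalEval a⁻¹ b⁻¹) hR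
  rw [evalEval_sub, evalEval_tauTwo, evalEval_mul, evalEval_add] at h1
  simp only [evalEval_C, eval_C, evalEval_X, eval_X] at h1
  have h2 := hf
  rw [tauF_eq Ap Am hp hq hc] at h2
  have h3 := left_ne_zero_of_mul h2
  have h4 := right_ne_zero_of_mul h2
  rw [nqcSRaw, casoratian_neg_one Ap Am hp hq hc ha hb, tauF_eq Ap Am hp hq hc, ← mul_sub, h1]
  field_simp

include hp hq hc hf hR in
-- The right-hand side is continuous in `b ≠ 0`, so it also gives the limit that defines the value
-- at `b = -a`.
theorem nqcS_eq {a b : ℂ} (ha : a ≠ 0) (hb : b ≠ 0) :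
    nqcS Ap Am p q c n m a b =
      -(a⁻¹ * (b⁻¹ * evalEval a⁻¹ b⁻¹ R)) / tau N (basePS p q c n m) := by
  by_cases hab : b = -a
  · subst hab
    rw [nqcS, Function.update_self]
    apply Tendsto.limUnder_eq
    have h1 : ContinuousAt (fun b : ℂ =>
        -(a⁻¹ * (b⁻¹ * evalEval a⁻¹ b⁻¹ R)) / tau N (basePS p q c n m)) (-a) := by
      have h2 : ContinuousAt (fun b : ℂ => b⁻¹) (-a) := continuousAt_inv₀ hb
      have h3 : ContinuousAt (fun b : ℂ => evalEval a⁻¹ b⁻¹ R) (-a) :=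
        (continuous_evalEval (continuous_const (y := a⁻¹)) continuous_id R).continuousAt.comp h2
      exact ((continuousAt_const.mul (h2.mul h3)).neg).div_const _
    refine (h1.tendsto.mono_left nhdsWithin_le_nhds).congr' ?_
    filter_upwards [self_mem_nhdsWithin, nhdsWithin_le_nhds (isOpen_ne.mem_nhds hb)] with b h4 h5
    refine (nqcSRaw_eq Ap Am hp hq hc hf hR ha h5 fun h6 => h4 ?_).symm
    exact eq_neg_of_add_eq_zero_right h6
  · rw [nqcS, Function.update_of_ne hab]
    exact nqcSRaw_eq Ap Am hp hq hc hf hR ha hb fun h6 =>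
      hab (eq_neg_of_add_eq_zero_right h6)

include hp hq hc hf hR in
theorem hasDerivAt_nqcS {a : ℂ} (ha : a ≠ 0) :
    HasDerivAt (nqcS Ap Am p q c n m a)
      (a⁻¹ ^ 3 * (evalEval a⁻¹ (-a⁻¹) R - a⁻¹ * evalEval a⁻¹ (-a⁻¹) (derivative R))
        / tau N (basePS p q c n m)) (-a) := by
  have hb : -a ≠ 0 := neg_ne_zero.mpr ha
  have h1 := hasDerivAt_inv hb
  have h2 : HasDerivAt (fun b : ℂ => evalEval a⁻¹ b⁻¹ R) _ (-a) :=
    (hasDerivAt_evalEval a⁻¹ (-a)⁻¹ R).comp (-a) h1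
  have h3 := (((h1.fun_mul h2).const_mul a⁻¹).fun_neg).div_const (tau N (basePS p q c n m))
  have h4 : nqcS Ap Am p q c n m a =ᶠ[𝓝 (-a)] fun b =>
      -(a⁻¹ * (b⁻¹ * evalEval a⁻¹ b⁻¹ R)) / tau N (basePS p q c n m) := by
    filter_upwards [isOpen_ne.mem_nhds hb] with b hb'
    exact nqcS_eq Ap Am hp hq hc hf hR ha hb'
  refine (h3.congr_of_eventuallyEq h4).congr_deriv ?_
  rw [inv_neg]
  field_simp
  ring

include hp hq hc hf hR in
theorem nqcU_eq {a : ℂ} (ha : a ≠ 0) :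
    nqcU Ap Am p q c n m a =
      -(a⁻¹ ^ 3 * (evalEval a⁻¹ (-a⁻¹) R - a⁻¹ * evalEval a⁻¹ (-a⁻¹) (derivative R))
        / tau N (basePS p q c n m)) := by
  have h1 : HasDerivAt (fun e : ℂ => 2 * a * e - a) (2 * a) 0 := by
    simpa using ((hasDerivAt_id (0 : ℂ)).const_mul (2 * a)).sub_const a
  have h2 := hasDerivAt_nqcS Ap Am hp hq hc hf hR ha
  have h3 : -a = 2 * a * 0 - a := by ring
  rw [h3] at h2
  have h4 := h2.comp (0 : ℂ) h1
  have h5 : deriv (fun e : ℂ => nqcS Ap Am p q c n m a (2 * a * e - a)) 0 = _ := h4.deriv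
  rw [nqcU, h5]
  field_simp

end NQC

theorem isBigO_pow_of_eq {f g : ℂ → ℂ} (k : ℕ) (hg : Continuous g)
    (hfg : ∀ e, e ≠ 0 → f e = e ^ k * g e) : f =O[𝓝[≠] 0] fun e : ℂ => e ^ k := by
  have h1 : g =O[𝓝[≠] 0] fun _ : ℂ => (1 : ℂ) :=
    (hg.tendsto 0).isBigO_one ℂ |>.mono nhdsWithin_le_nhds
  have h2 := (isBigO_refl (fun e : ℂ => e ^ k) (𝓝[≠] 0)).mul h1
  simp only [mul_one] at h2
  refine h2.congr' ?_ EventuallyEq.rfl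
  filter_upwards [self_mem_nhdsWithin] with e he
  exact (hfg e he).symm

/-! ### Expansions as `a → ∞` and the limit of the Q2 solution -/

section Expansion

open Polynomial

/-- With `a = 1 / e` all four quantities are polynomial in `e`. The explicit functions `g` are the
exact remainders left by the quadratic terms `U₁, U₂, U₃` of `R`. In the sum of the two `U` values
the `τ₁` terms are odd in `a` and cancel. -/
theorem isNqcExpansion {N : ℕ} (Ap Am : Matrix (Fin N) (Fin N) ℂ) {p q c : ℂ} (hp : p ≠ 0)
    (hq : q ≠ 0) (hc : c ≠ 0) {n m : ℤ} (hf : tauF Ap Am p q c n m ≠ 0) :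
    IsNqcExpansion Ap Am p q c n m
      (tauLast N 1 (basePS p q c n m) / tau N (basePS p q c n m))
      (tauLast N 2 (basePS p q c n m) / tau N (basePS p q c n m)) := by
  obtain ⟨R, U₁, U₂, U₃, hR, hexp⟩ := exists_tauTwo_sub N (basePS p q c n m)
  have hS := @nqcS_eq N Ap Am p q c hp hq hc n m hf R hR
  have hU := @nqcU_eq N Ap Am p q c hp hq hc n m hf R hR
  have hτ := tau_basePS_ne_zero Ap Am hp hq hc hf
  set τ := tau N (basePS p q c n m)
  set τ₁ := tauLast N 1 (basePS p q c n m)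
  set τ₂ := tauLast N 2 (basePS p q c n m)
  have hRv : ∀ x y : ℂ, evalEval x y R = -τ₁ + τ₂ * (x + y) + x ^ 2 * evalEval x y U₁ +
      x * y * evalEval x y U₂ + y ^ 2 * evalEval x y U₃ := fun x y => by
    rw [hexp]
    simp only [evalEval_add, evalEval_mul, evalEval_pow, evalEval_C, evalEval_X, eval_C, eval_X]
  have hDv : ∀ x y : ℂ, evalEval x y (derivative R) = τ₂ +
      x ^ 2 * evalEval x y (derivative U₁) +
      x * (evalEval x y U₂ + y * evalEval x y (derivative U₂)) +
      (2 * y * evalEval x y U₃ + y ^ 2 * evalEval x y (derivative U₃)) := fun x y => by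
    rw [hexp]
    simp only [derivative_add, derivative_mul, derivative_C, derivative_X, derivative_pow,
      evalEval_add, evalEval_mul, evalEval_pow, evalEval_C, evalEval_X, eval_C, eval_X,
      evalEval_zero, evalEval_one]
    simp
    ring
  have hcont : ∀ (U : ℂ[X][X]) (s t : ℂ), Continuous fun e : ℂ => evalEval (s * e) (t * e) U :=
    fun U s t => continuous_evalEval (by fun_prop) (by fun_prop) U
  -- Continuity along the four directions `(±e, ±e)`, in the form in which `fun_prop` uses it for
  -- the remainders.
  have c1 := fun U => by simpa using hcont U 1 1
  have c2 := fun U => by simpa using hcont U 1 (-1)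
  have c3 := fun U => by simpa using hcont U (-1) 1
  have c4 := fun U => by simpa using hcont U (-1) (-1)
  refine ⟨?_, ?_, ?_, ?_⟩
  · refine isBigO_pow_of_eq (g := fun e => e * (evalEval (-e) e U₁ - evalEval (-e) e U₂ +
      evalEval (-e) e U₃) / τ) 2 (by fun_prop) fun e he => ?_
    rw [hS (by simpa using he) (by simpa using he)]
    simp only [one_div, inv_inv, inv_neg]
    rw [hRv]
    field_simp
    ring
  · refine isBigO_pow_of_eq (g := fun e => -(evalEval e e U₁ + evalEval e e U₂ +
      evalEval e e U₃) / τ) 3 (by fun_prop) fun e he => ?_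
    rw [hS (by simpa using he) (by simpa using he)]
    simp only [one_div, inv_inv]
    rw [hRv]
    field_simp
    ring
  · refine isBigO_pow_of_eq (g := fun e => -(evalEval (-e) (-e) U₁ + evalEval (-e) (-e) U₂ +
      evalEval (-e) (-e) U₃) / τ) 3 (by fun_prop) fun e he => ?_
    rw [hS (by simpa using he) (by simpa using he)]
    simp only [one_div, inv_inv, inv_neg]
    rw [hRv]
    field_simp
    ring
  · refine isBigO_pow_of_eq (g := fun e =>
      ((evalEval (-e) e U₁ - evalEval (-e) e U₂ + evalEval (-e) e U₃)
        - (evalEval e (-e) U₁ - evalEval e (-e) U₂ + evalEval e (-e) U₃)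
        + (e * evalEval (-e) e (derivative U₁)
            - (evalEval (-e) e U₂ + e * evalEval (-e) e (derivative U₂))
            + (2 * evalEval (-e) e U₃ + e * evalEval (-e) e (derivative U₃)))
        + (e * evalEval e (-e) (derivative U₁)
            + (evalEval e (-e) U₂ - e * evalEval e (-e) (derivative U₂))
            + (-2 * evalEval e (-e) U₃ + e * evalEval e (-e) (derivative U₃)))) / τ) 3
      (by fun_prop) fun e he => ?_
    rw [hU (by simpa using he), hU (by simpa using he)]
    simp only [one_div, inv_inv, inv_neg, neg_neg]
    rw [hRv, hRv, hDv, hDv]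
    field_simp
    ring

end Expansion

theorem tendsto_div_pow_of_isBigO {f : ℂ → ℂ} {L : ℂ} (k : ℕ)
    (h : (fun e => f e - L * e ^ k) =O[𝓝[≠] 0] fun e : ℂ => e ^ (k + 1)) :
    Tendsto (fun e => f e / e ^ k) (𝓝[≠] 0) (𝓝 L) := by
  have h1 : (fun e : ℂ => e ^ (k + 1)) =o[𝓝[≠] 0] fun e : ℂ => e ^ k :=
    (isLittleO_pow_pow (𝕜 := ℂ) (Nat.lt_succ_self k)).mono nhdsWithin_le_nhds
  have h2 := (h.trans_isLittleO h1).tendsto_div_nhds_zero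
  have h3 := h2.add_const L
  rw [zero_add] at h3
  refine h3.congr' ?_
  filter_upwards [self_mem_nhdsWithin] with e he
  have he' : e ≠ 0 := he
  field_simp
  ring

/-- `ρ(1 / ε)` extended to `ε = 0`. -/
noncomputable def rhoInv (p q : ℂ) (n m : ℤ) (e : ℂ) : ℂ :=
  ((p * e + 1) / (p * e - 1)) ^ n * ((q * e + 1) / (q * e - 1)) ^ m

theorem rho_one_div (p q : ℂ) (n m : ℤ) {e : ℂ} (he : e ≠ 0) :
    rho p q n m (1 / e) = rhoInv p q n m e := by
  have h : ∀ p : ℂ, (p + 1 / e) / (p - 1 / e) = (p * e + 1) / (p * e - 1) := fun p => by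
    rw [← mul_div_mul_right (p + 1 / e) (p - 1 / e) he]
    congr 1 <;> field_simp
  rw [rho, rhoInv, h, h]

theorem rhoInv_zero (p q : ℂ) (n m : ℤ) : rhoInv p q n m 0 = (-1) ^ (n + m) := by
  simp [rhoInv, zpow_add₀]

theorem hasDerivAt_rhoInv (p q : ℂ) (n m : ℤ) :
    HasDerivAt (rhoInv p q n m) ((-1) ^ (n + m) * zetaVar p q n m) 0 := by
  have h : ∀ (p : ℂ) (n : ℤ), HasDerivAt (fun e : ℂ => ((p * e + 1) / (p * e - 1)) ^ n)
      ((-1) ^ n * (2 * (n * p))) 0 := fun p n => by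
    have h1 : HasDerivAt (fun e : ℂ => p * e) p 0 := by
      simpa using (hasDerivAt_id (0 : ℂ)).const_mul p
    have h2 := (h1.add_const 1).fun_div (h1.sub_const 1) (by simp)
    have h3 := (hasDerivAt_zpow n ((p * 0 + 1) / (p * 0 - 1)) (Or.inl (by simp))).comp (0 : ℂ) h2
    refine h3.congr_deriv ?_
    simp only [mul_zero, zero_add, zero_sub, div_neg, div_one]
    rw [zpow_sub_one₀ (by simp)]
    ring
  refine ((h p n).fun_mul (h q m)).congr_deriv ?_
  simp only [mul_zero, zero_add, zero_sub, div_neg, div_one]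
  rw [zpow_add₀ (by simp), zetaVar]
  ring

theorem tendsto_rho (p q : ℂ) (n m : ℤ) :
    Tendsto (fun e : ℂ => rho p q n m (1 / e)) (𝓝[≠] 0) (𝓝 ((-1) ^ (n + m))) ∧
    Tendsto (fun e : ℂ => (rho p q n m (1 / e) - (-1) ^ (n + m)) / e) (𝓝[≠] 0)
      (𝓝 ((-1) ^ (n + m) * zetaVar p q n m)) := by
  have h1 := hasDerivAt_rhoInv p q n m
  constructor
  · have h2 := h1.continuousAt.tendsto.mono_left (nhdsWithin_le_nhds (s := {0}ᶜ))
    rw [rhoInv_zero] at h2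
    refine h2.congr' ?_
    filter_upwards [self_mem_nhdsWithin] with e he
    exact (rho_one_div p q n m he).symm
  · refine (hasDerivAt_iff_tendsto_slope.mp h1).congr' ?_
    filter_upwards [self_mem_nhdsWithin] with e he
    rw [slope_def_field, rhoInv_zero, rho_one_div p q n m he, sub_zero]

theorem tendsto_rho_neg (p q : ℂ) (n m : ℤ) :
    Tendsto (fun e : ℂ => rho p q n m (-(1 / e))) (𝓝[≠] 0) (𝓝 ((-1) ^ (n + m))) ∧
    Tendsto (fun e : ℂ => (rho p q n m (-(1 / e)) - (-1) ^ (n + m)) / e) (𝓝[≠] 0)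
      (𝓝 (-((-1) ^ (n + m) * zetaVar p q n m))) := by
  have h0 : Tendsto (fun e : ℂ => -e) (𝓝[≠] 0) (𝓝[≠] 0) := by
    refine tendsto_nhdsWithin_iff.mpr ⟨?_, ?_⟩
    · have : Tendsto (fun e : ℂ => -e) (𝓝 0) (𝓝 (-0)) := continuous_neg.tendsto 0
      rw [neg_zero] at this
      exact this.mono_left nhdsWithin_le_nhds
    · filter_upwards [self_mem_nhdsWithin] with e he
      simpa using he
  obtain ⟨h1, h2⟩ := tendsto_rho p q n m
  constructor
  · refine (h1.comp h0).congr fun e => ?_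
    simp
  · refine ((h2.comp h0).neg).congr fun e => ?_
    simp [div_neg]

theorem tendsto_xiVar (p q : ℂ) (n m : ℤ) :
    Tendsto (fun e : ℂ => xiVar p q n m (1 / e) / e) (𝓝[≠] 0) (𝓝 (zetaVar p q n m)) := by
  have h : ∀ p : ℂ, ContinuousAt (fun e : ℂ => p / (1 - p ^ 2 * e ^ 2)) 0 := fun p => by
    refine continuousAt_const.div (by fun_prop) (by simp)
  have h1 : ContinuousAt (fun e : ℂ => 2 * (p / (1 - p ^ 2 * e ^ 2) * n +
      q / (1 - q ^ 2 * e ^ 2) * m)) 0 :=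
    continuousAt_const.mul (((h p).mul continuousAt_const).add ((h q).mul continuousAt_const))
  have h2 := h1.tendsto.mono_left (nhdsWithin_le_nhds (s := {0}ᶜ))
  have h3 : 2 * (p / (1 - p ^ 2 * 0 ^ 2) * n + q / (1 - q ^ 2 * 0 ^ 2) * m) =
      zetaVar p q n m := by
    simp [zetaVar]; ring
  rw [h3] at h2
  refine h2.congr' ?_
  filter_upwards [self_mem_nhdsWithin] with e he
  have he' : e ≠ 0 := he
  have h4 : ∀ p : ℂ, p / ((1 / e) ^ 2 - p ^ 2) = e ^ 2 * (p / (1 - p ^ 2 * e ^ 2)) := fun p => by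
    rw [← mul_div_mul_right p _ (pow_ne_zero 2 he')]
    have : ((1 / e) ^ 2 - p ^ 2) * e ^ 2 = 1 - p ^ 2 * e ^ 2 := by field_simp
    rw [this]
    ring
  rw [xiVar, h4, h4]
  field_simp

/-- The constants are chosen so that the terms of order `ε` cancel: both `ρ(±a)` tend to
`(-1)^(n+m)` while the leading parts of `A` and `D` are opposite. The first-order terms of `ρ(±a)`
and of `a S(±a, ±a)` then survive, and the product of the two constants contributes `-A²`. -/
theorem tendsto_q2Sol {N : ℕ} (Ap Am : Matrix (Fin N) (Fin N) ℂ) (p q c : ℂ) (n m : ℤ)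
    (S₀ S₁ : ℤ → ℤ → ℂ) (h : IsNqcExpansion Ap Am p q c n m (S₀ n m) (S₁ n m)) (A ζ₀ ζ₁ : ℂ) :
    Tendsto
      (fun ε : ℂ =>
        (q2Sol Ap Am p q c n m (1 / ε) (A * (ε + ζ₁ * ε ^ 2 / 2))
          (A * (-ε + ζ₁ * ε ^ 2 / 2)) (ε * ζ₀) - 1 / 4) / ε ^ 2)
      (𝓝[≠] 0) (𝓝 (h2Sol S₀ S₁ p q A ζ₀ ζ₁ n m)) := by
  obtain ⟨h1, h2, h3, h4⟩ := h
  have hpow : ∀ k : ℕ, (fun e : ℂ => e ^ (k + 1)) =O[𝓝[≠] 0] fun e : ℂ => e ^ k := fun k =>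
    (isLittleO_pow_pow (𝕜 := ℂ) (Nat.lt_succ_self k)).isBigO.mono nhdsWithin_le_nhds
  have hsq : ∀ z : ℂ, (fun e : ℂ => z * e ^ 2) =O[𝓝[≠] 0] fun e : ℂ => e ^ 2 := fun z =>
    isBigO_const_mul_self z _ _
  have t1 := tendsto_div_pow_of_isBigO (L := -S₀ n m)
    (f := fun ε => 1 / ε * nqcS Ap Am p q c n m (-(1 / ε)) (1 / ε)) 1
    (h1.congr_left fun e => by ring)
  have t2 := tendsto_div_pow_of_isBigO (L := S₀ n m)
    (f := fun ε => 1 / ε * nqcS Ap Am p q c n m (1 / ε) (1 / ε)) 1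
    (((h2.trans (hpow 2)).sub (hsq (2 * S₁ n m))).congr_left fun e => by ring)
  have t3 := tendsto_div_pow_of_isBigO (L := S₀ n m)
    (f := fun ε => 1 / ε * nqcS Ap Am p q c n m (-(1 / ε)) (-(1 / ε))) 1
    (((h3.trans (hpow 2)).add (hsq (2 * S₁ n m))).congr_left fun e => by ring)
  have t4 := tendsto_div_pow_of_isBigO (L := 2 * S₁ n m)
    (f := fun ε => (1 / ε) ^ 2 *
      (nqcU Ap Am p q c n m (-(1 / ε)) + nqcU Ap Am p q c n m (1 / ε))) 2
    (h4.congr_left fun e => by ring)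
  have tx := (tendsto_xiVar p q n m).add_const ζ₀
  obtain ⟨r1, r2⟩ := tendsto_rho p q n m
  obtain ⟨r3, r4⟩ := tendsto_rho_neg p q n m
  have te : Tendsto (fun e : ℂ => e) (𝓝[≠] 0) (𝓝 0) := tendsto_id.mono_left nhdsWithin_le_nhds
  -- `d1, d2` are the first-order coefficients of `ρ(a)(1 - 2 a S(a, a))` and `ρ(-a)(1 + 2 a S(-a,
  -- -a))`. `s1, s2` are their limits, which are multiplied by `ζ₁ / 2`.
  have d1 := r2.sub ((r1.mul t2).const_mul 2)
  have d2 := r4.add ((r3.mul t3).const_mul 2)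
  have s1 := r1.mul ((((te.mul t2).const_mul 2)).const_sub 1)
  have s2 := r3.mul ((((te.mul t3).const_mul 2)).const_add 1)
  have hAD := (((te.pow 2).const_mul (ζ₁ ^ 2 / 4)).sub_const 1).const_mul (A ^ 2)
  have total := ((((tx.pow 2).const_mul (1 / 4)).add (tx.mul t1)).add t4).add
    (hAD.add (((d1.sub d2).add ((s1.add s2).const_mul (ζ₁ / 2))).const_mul (A / 2)))
  convert total.congr' ?_ using 1
  · rw [h2Sol]
    congr 1
    ring
  · filter_upwards [self_mem_nhdsWithin] with e he
    have he' : e ≠ 0 := he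
    rw [q2Sol]
    field_simp
    ring

/-! ### From the edge relations to H2 -/

/-- On an elementary quadrilateral the edge relations between `S₀` and `S₁` imply H2. -/
theorem satisfiesH2At_h2Sol (S₀ S₁ : ℤ → ℤ → ℂ) (p q A ζ₀ ζ₁ : ℂ) (n m : ℤ)
    (e₁ : p * (S₀ (n + 1) m - S₀ n m) = S₁ (n + 1) m + S₁ n m - S₀ (n + 1) m * S₀ n m)
    (e₂ : p * (S₀ (n + 1) (m + 1) - S₀ n (m + 1)) =
      S₁ (n + 1) (m + 1) + S₁ n (m + 1) - S₀ (n + 1) (m + 1) * S₀ n (m + 1))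
    (e₃ : q * (S₀ n (m + 1) - S₀ n m) = S₁ n (m + 1) + S₁ n m - S₀ n (m + 1) * S₀ n m)
    (e₄ : q * (S₀ (n + 1) (m + 1) - S₀ (n + 1) m) =
      S₁ (n + 1) (m + 1) + S₁ (n + 1) m - S₀ (n + 1) (m + 1) * S₀ (n + 1) m) :
    SatisfiesH2At p q (h2Sol S₀ S₁ p q A ζ₀ ζ₁) n m := by
  have hneg : (-1 : ℂ) ≠ 0 := by simp
  have g1 : (-1 : ℂ) ^ (n + 1 + m) = -(-1) ^ (n + m) := by
    rw [add_right_comm, zpow_add_one₀ hneg]; ring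
  have g2 : (-1 : ℂ) ^ (n + (m + 1)) = -(-1) ^ (n + m) := by
    rw [← add_assoc, zpow_add_one₀ hneg]; ring
  have g12 : (-1 : ℂ) ^ (n + 1 + (m + 1)) = (-1) ^ (n + m) := by
    rw [← add_assoc, zpow_add_one₀ hneg, g1]; ring
  have gsq : (-1 : ℂ) ^ (n + m) * (-1) ^ (n + m) = 1 := by
    rw [← mul_zpow]; simp
  have z1 : zetaVar p q (n + 1) m = zetaVar p q n m + 2 * p := by
    simp only [zetaVar]; push_cast; ring
  have z2 : zetaVar p q n (m + 1) = zetaVar p q n m + 2 * q := by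
    simp only [zetaVar]; push_cast; ring
  have z12 : zetaVar p q (n + 1) (m + 1) = zetaVar p q n m + 2 * p + 2 * q := by
    simp only [zetaVar]; push_cast; ring
  rw [SatisfiesH2At]
  set σ := (-1 : ℂ) ^ (n + m)
  set z := zetaVar p q n m
  -- The H1 variable at the four vertices. The sign in front of `σ * A` alternates with the parity
  -- of the vertex, so it drops out of both diagonal differences.
  obtain ⟨Y, hY⟩ : ∃ Y, Y = (z + ζ₀) / 2 - S₀ n m - σ * A := ⟨_, rfl⟩
  obtain ⟨Y1, hY1⟩ : ∃ Y, Y = (z + 2 * p + ζ₀) / 2 - S₀ (n + 1) m + σ * A := ⟨_, rfl⟩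
  obtain ⟨Y2, hY2⟩ : ∃ Y, Y = (z + 2 * q + ζ₀) / 2 - S₀ n (m + 1) + σ * A := ⟨_, rfl⟩
  obtain ⟨Y12, hY12⟩ : ∃ Y, Y = (z + 2 * p + 2 * q + ζ₀) / 2 - S₀ (n + 1) (m + 1) - σ * A :=
    ⟨_, rfl⟩
  -- In this combination of the four edge relations every `S₁` cancels.
  have hH1 : (Y12 - Y) * (Y1 - Y2) = p ^ 2 - q ^ 2 := by
    rw [hY, hY1, hY2, hY12]
    linear_combination e₃ + e₄ - e₁ - e₂
  -- On each edge the sum of the two `u` is quadratic in `Y`: this is the Bäcklund transformation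
  -- between H1 and H2. The term with `ζ₁` cancels because its sign alternates.
  have u1 : h2Sol S₀ S₁ p q A ζ₀ ζ₁ n m + h2Sol S₀ S₁ p q A ζ₀ ζ₁ (n + 1) m =
      p ^ 2 + 2 * Y * Y1 := by
    rw [hY, hY1, h2Sol, h2Sol, g1, z1]
    linear_combination (2 * A ^ 2) * gsq - 2 * e₁
  have u2 : h2Sol S₀ S₁ p q A ζ₀ ζ₁ n m + h2Sol S₀ S₁ p q A ζ₀ ζ₁ n (m + 1) =
      q ^ 2 + 2 * Y * Y2 := by
    rw [hY, hY2, h2Sol, h2Sol, g2, z2]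
    linear_combination (2 * A ^ 2) * gsq - 2 * e₃
  have u3 : h2Sol S₀ S₁ p q A ζ₀ ζ₁ (n + 1) m + h2Sol S₀ S₁ p q A ζ₀ ζ₁ (n + 1) (m + 1) =
      q ^ 2 + 2 * Y1 * Y12 := by
    rw [hY1, hY12, h2Sol, h2Sol, g1, g12, z1, z12]
    linear_combination (2 * A ^ 2) * gsq - 2 * e₄
  have v1 : h2Sol S₀ S₁ p q A ζ₀ ζ₁ n m - h2Sol S₀ S₁ p q A ζ₀ ζ₁ (n + 1) (m + 1) =
      p ^ 2 - q ^ 2 - 2 * Y1 * (Y12 - Y) := by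
    linear_combination u1 - u3
  have v2 : h2Sol S₀ S₁ p q A ζ₀ ζ₁ (n + 1) m - h2Sol S₀ S₁ p q A ζ₀ ζ₁ n (m + 1) =
      p ^ 2 - q ^ 2 + 2 * Y * (Y1 - Y2) := by
    linear_combination u1 - u2
  rw [v1, v2]
  linear_combination (p ^ 2 - q ^ 2) * (u2 + u3) - 4 * Y * Y1 * hH1

theorem mainTheorem8 (N : ℕ) (Ap Am : Matrix (Fin N) (Fin N) ℂ)
    (hAp : IsLowerTriangularToeplitz Ap) (hAm : IsLowerTriangularToeplitz Am)
    (hApdet : IsUnit Ap.det) (hAmdet : IsUnit Am.det)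
    (p q c : ℂ) (hp : p ≠ 0) (hq : q ≠ 0) (hc : c ≠ 0) :
    ∃ S₀ S₁ : ℤ → ℤ → ℂ,
      (∀ n m : ℤ, tauF Ap Am p q c n m ≠ 0 →
        (∀ a : ℂ, a ≠ 0 → DifferentiableAt ℂ (nqcS Ap Am p q c n m a) (-a)) ∧
        IsNqcExpansion Ap Am p q c n m (S₀ n m) (S₁ n m) ∧
        ∀ A ζ₀ ζ₁ : ℂ,
          Tendsto
            (fun ε : ℂ =>
              (q2Sol Ap Am p q c n m (1 / ε) (A * (ε + ζ₁ * ε ^ 2 / 2))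
                (A * (-ε + ζ₁ * ε ^ 2 / 2)) (ε * ζ₀) - 1 / 4) / ε ^ 2)
            (𝓝[≠] 0) (𝓝 (h2Sol S₀ S₁ p q A ζ₀ ζ₁ n m))) ∧
      (∀ (A ζ₀ ζ₁ : ℂ) (n m : ℤ),
        tauF Ap Am p q c n m ≠ 0 → tauF Ap Am p q c (n + 1) m ≠ 0 →
        tauF Ap Am p q c n (m + 1) ≠ 0 → tauF Ap Am p q c (n + 1) (m + 1) ≠ 0 →
        SatisfiesH2At p q (h2Sol S₀ S₁ p q A ζ₀ ζ₁) n m) ∧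
      (∃ F G₀ G₁ : MvPolynomial (Fin 2) ℂ, ∀ n m : ℤ,
        (MvPolynomial.eval ![(n : ℂ), (m : ℂ)] F = 0 ↔ tauF Ap Am p q c n m = 0) ∧
        (tauF Ap Am p q c n m ≠ 0 →
          S₀ n m = MvPolynomial.eval ![(n : ℂ), (m : ℂ)] G₀
            / MvPolynomial.eval ![(n : ℂ), (m : ℂ)] F ∧
          S₁ n m = MvPolynomial.eval ![(n : ℂ), (m : ℂ)] G₁
            / MvPolynomial.eval ![(n : ℂ), (m : ℂ)] F)) := by
  have hτ := fun n m => @tau_basePS_ne_zero N Ap Am p q c hp hq hc n m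
  refine ⟨fun n m => tauLast N 1 (basePS p q c n m) / tau N (basePS p q c n m),
    fun n m => tauLast N 2 (basePS p q c n m) / tau N (basePS p q c n m), ?_, ?_, ?_⟩
  · intro n m hf
    have hexp := isNqcExpansion Ap Am hp hq hc hf
    refine ⟨fun a ha => ?_, hexp, fun A ζ₀ ζ₁ => ?_⟩
    · obtain ⟨R, -, -, -, hR, -⟩ := exists_tauTwo_sub N (basePS p q c n m)
      exact (hasDerivAt_nqcS Ap Am hp hq hc hf hR ha).differentiableAt
    · exact tendsto_q2Sol Ap Am p q c n m _ _ hexp A ζ₀ ζ₁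
  · intro A ζ₀ ζ₁ n m h h1 h2 h12
    replace h := hτ _ _ h
    replace h1 := hτ _ _ h1
    replace h2 := hτ _ _ h2
    replace h12 := hτ _ _ h12
    have left : ∀ m : ℤ, basePS p q c (n + 1) m = _ := basePS_add_one_left hp q c n
    have right : ∀ n : ℤ, basePS p q c n (m + 1) = _ := fun n => basePS_add_one_right p hq c n m
    apply satisfiesH2At_h2Sol
    · have := tauLast_div_tau_relation N _ p h (left m ▸ h1)
      rwa [← left] at this
    · have := tauLast_div_tau_relation N _ p h2 (left (m + 1) ▸ h12)
      rwa [← left] at this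
    · have := tauLast_div_tau_relation N _ q h (right n ▸ h2)
      rwa [← right] at this
    · have := tauLast_div_tau_relation N _ q h1 (right (n + 1) ▸ h12)
      rwa [← right] at this
  -- The factor `det (Ap + Am)` is kept so that `F` also vanishes when this determinant is zero. The
  -- nonzero factor `(p ^ n * q ^ m) ^ N` is not polynomial in `(n, m)`, but it cancels in the
  -- quotients and does not affect the zeros.
  · refine ⟨MvPolynomial.C (Ap + Am).det * tau N (polyPS p q c),
      MvPolynomial.C (Ap + Am).det * tauLast N 1 (polyPS p q c),
      MvPolynomial.C (Ap + Am).det * tauLast N 2 (polyPS p q c), fun n m => ?_⟩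
    have hpq : (p ^ n * q ^ m) ^ N ≠ 0 :=
      pow_ne_zero _ (mul_ne_zero (zpow_ne_zero _ hp) (zpow_ne_zero _ hq))
    simp only [map_mul, MvPolynomial.eval_C]
    rw [tauF_eq Ap Am hp hq hc, basePS_eq hp hq, tau_C_mul, tau_map, tauLast_C_mul, tauLast_map,
      tauLast_C_mul, tauLast_map]
    constructor
    · simp [hpq]
    · intro h
      have hdet := left_ne_zero_of_mul h
      exact ⟨by rw [mul_div_mul_left _ _ hpq, mul_div_mul_left _ _ hdet],
        by rw [mul_div_mul_left _ _ hpq, mul_div_mul_left _ _ hdet]⟩
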